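/- Let $\mathcal{A}$ be an essential central arrangement of $n$ distinct hyperplanes in $V=\mathbb{C}^\ell$, the $i$-th hyperplane being the kernel of a nonzero linear form $f_i$ on $V$; essential means that some $\ell$ of the forms $f_1,\dots,f_n$ are linearly independent. Let $R=\mathbb{C}[x_1,\dots,x_\ell]$ and $Q=\prod_{i=1}^n f_i\in R$, let $\Bbbk=\mathbb{C}[a_1,\dots,a_n]$ and $S=\Bbbk\otimes_{\mathbb{C}} R=\Bbbk[x_1,\dots,x_\ell]$. For $(T,k)=(R,\mathbb{C})$ or $(S,\Bbbk)$, let $\mathrm{Der}_k(\mathcal{A})=\{\theta\in\mathrm{Der}_k(T):\theta(Q)\in(Q)\}$ be the $T$-module of logarithmic derivations. The arrangement $\mathcal{A}$ is called free if $\mathrm{Der}_{\mathbb{C}}(\mathcal{A})$ is a free $R$-module. Let $\omega_{\mathbf a}=\sum_{i=1}^n a_i\,\frac{df_i}{f_i}\in\Omega^1_{S_Q/\Bbbk}$, and let the logarithmic ideal of critical sets $I=I(\mathcal{A})\subseteq S$ be the ideal generated by all elements $$\langle\theta,\omega_{\mathbf a}\rangle=\sum_{i=1}^n a_i\,\frac{\theta(f_i)}{f_i},\qquad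 \theta\in\mathrm{Der}_{\Bbbk}(\mathcal{A}),$$ which lie in $S$. Then the ideal $I$ is a complete intersection, that is, $I$ can be generated by $\operatorname{codim} I$ elements (where $\operatorname{codim} I$ is the height of $I$), if and only if $\mathcal{A}$ is free. -/

import Mathlib

open scoped KaehlerDifferential

noncomputable section

/-- A central arrangement of `n` (distinct) hyperplanes in `V = ℂ^ℓ`, given by defining linear
forms `f_1, …, f_n`; the `i`-th hyperplane is the kernel of `f_i`. -/
structure CentralArrangement (ℓ n : ℕ) where
  /-- the defining linear forms -/
  form : Fin n → Module.Dual ℂ (Fin ℓ → ℂ)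
  form_ne_zero : ∀ i, form i ≠ 0
  /-- the hyperplanes are pairwise distinct -/
  ker_injective : Function.Injective fun i => LinearMap.ker (form i)

namespace CentralArrangement

variable {ℓ n : ℕ} (A : CentralArrangement ℓ n)

/-- The arrangement contains `ℓ` linearly independent hyperplanes. -/
def IsEssential : Prop :=
  ∃ e : Fin ℓ → Fin n, LinearIndependent ℂ fun j => A.form (e j)

section Coefficients

variable (k : Type) [CommRing k] [Algebra ℂ k]

/-- The linear form `f_i = ∑ j, c_ij x_j` as an element of the polynomial ring
`k[x_1, …, x_ℓ]`. -/
def poly (i : Fin n) : MvPolynomial (Fin ℓ) k :=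
  ∑ j, MvPolynomial.C (algebraMap ℂ k (A.form i (Pi.single j 1))) * MvPolynomial.X j

/-- The defining polynomial `Q = f_1 ⋯ f_n` in `k[x_1, …, x_ℓ]`. -/
def definingPoly : MvPolynomial (Fin ℓ) k :=
  ∏ i, A.poly k i

/-- The module `Der_k(A)` of logarithmic derivations: the `k`-linear derivations `θ` of
`T = k[x_1, …, x_ℓ]` with `θ(Q) ∈ (Q)`, as a `T`-module. -/
def logDer : Submodule (MvPolynomial (Fin ℓ) k)
    (Derivation k (MvPolynomial (Fin ℓ) k) (MvPolynomial (Fin ℓ) k)) where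
  carrier := {θ | θ (A.definingPoly k) ∈ Ideal.span {A.definingPoly k}}
  add_mem' := fun {x y} hx hy => by
    change (x + y) (A.definingPoly k) ∈ Ideal.span {A.definingPoly k}
    rw [Derivation.add_apply]
    exact Ideal.add_mem _ hx hy
  zero_mem' := by
    change (0 : Derivation k (MvPolynomial (Fin ℓ) k) (MvPolynomial (Fin ℓ) k))
      (A.definingPoly k) ∈ Ideal.span {A.definingPoly k}
    rw [Derivation.zero_apply]
    exact Ideal.zero_mem _
  smul_mem' := fun c x hx => by
    change (c • x) (A.definingPoly k) ∈ Ideal.span {A.definingPoly k}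
    rw [Derivation.smul_apply, smul_eq_mul]
    exact Ideal.mul_mem_left _ c hx

/-- The localization `T_Q` of `T = k[x_1, …, x_ℓ]`. -/
abbrev Loc : Type := Localization.Away (A.definingPoly k)

theorem isUnit_poly (i : Fin n) :
    IsUnit (algebraMap (MvPolynomial (Fin ℓ) k) (A.Loc k) (A.poly k i)) :=
  isUnit_of_dvd_unit
    (map_dvd _ (Finset.dvd_prod_of_mem (fun i => A.poly k i) (Finset.mem_univ i)))
    (IsLocalization.Away.algebraMap_isUnit (A.definingPoly k))

/-- The element `1 / f_i` of `T_Q`. -/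
def invPoly (i : Fin n) : A.Loc k :=
  ((A.isUnit_poly k i).unit⁻¹ : (A.Loc k)ˣ)

theorem isUnit_algebraMap_end (q : Submonoid.powers (A.definingPoly k)) :
    IsUnit (algebraMap (MvPolynomial (Fin ℓ) k)
      (Module.End (MvPolynomial (Fin ℓ) k) (A.Loc k)) q) := by
  rw [Module.End.isUnit_iff]
  have hq : IsUnit (algebraMap (MvPolynomial (Fin ℓ) k) (A.Loc k) q) :=
    IsLocalization.map_units _ q
  have h : ⇑(algebraMap (MvPolynomial (Fin ℓ) k)
      (Module.End (MvPolynomial (Fin ℓ) k) (A.Loc k)) q) =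
      fun z => algebraMap (MvPolynomial (Fin ℓ) k) (A.Loc k) q * z := by
    funext z
    rw [Module.algebraMap_end_apply, Algebra.smul_def]
  rw [h]
  exact IsUnit.isUnit_iff_mulLeft_bijective.mp hq

/-- The duality pairing `η ↦ ⟨θ, η⟩` of a derivation `θ ∈ Der_k(T)` with rational `1`-forms
`η ∈ Ω¹_{T_Q/k}`: the unique `T`-linear map with values in `T_Q` such that `⟨θ, dg⟩ = θ(g)`
for all `g ∈ T` (here `Ω¹_{T_Q/k}` is the localization of `Ω¹_{T/k}` at `Q`). -/
def pairing (θ : Derivation k (MvPolynomial (Fin ℓ) k) (MvPolynomial (Fin ℓ) k)) :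
    Ω[A.Loc k⁄k] →ₗ[MvPolynomial (Fin ℓ) k] A.Loc k :=
  IsLocalizedModule.lift (Submonoid.powers (A.definingPoly k))
    (KaehlerDifferential.map k k (MvPolynomial (Fin ℓ) k) (A.Loc k))
    ((Algebra.linearMap (MvPolynomial (Fin ℓ) k) (A.Loc k)).compDer θ).liftKaehlerDifferential
    (A.isUnit_algebraMap_end k)

theorem pairing_D (θ : Derivation k (MvPolynomial (Fin ℓ) k) (MvPolynomial (Fin ℓ) k))
    (g : MvPolynomial (Fin ℓ) k) :
    A.pairing k θ (KaehlerDifferential.D k (A.Loc k)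
      (algebraMap (MvPolynomial (Fin ℓ) k) (A.Loc k) g)) =
      algebraMap (MvPolynomial (Fin ℓ) k) (A.Loc k) (θ g) := by
  rw [← KaehlerDifferential.map_D k k (MvPolynomial (Fin ℓ) k) (A.Loc k), pairing,
    IsLocalizedModule.lift_apply, Derivation.liftKaehlerDifferential_comp_D]
  rfl

end Coefficients

/-- The ring `ℂ[a_1, …, a_n]` of weights. -/
abbrev Weights (n : ℕ) : Type := MvPolynomial (Fin n) ℂ

/-- The ring `S = ℂ[a_1, …, a_n] ⊗ ℂ[x_1, …, x_ℓ]`, as the polynomial ring in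
`x_1, …, x_ℓ` over `ℂ[a_1, …, a_n]`. -/
abbrev BigRing (ℓ n : ℕ) : Type := MvPolynomial (Fin ℓ) (Weights n)

/-- The universal `1`-form `ω_a = ∑ i, a_i (df_i / f_i)`. -/
def universalForm : Ω[A.Loc (Weights n)⁄Weights n] :=
  ∑ i, (MvPolynomial.X i : Weights n) • A.invPoly (Weights n) i •
    KaehlerDifferential.D (Weights n) (A.Loc (Weights n))
      (algebraMap (BigRing ℓ n) (A.Loc (Weights n)) (A.poly (Weights n) i))

theorem pairing_universalForm
    (θ : Derivation (Weights n) (BigRing ℓ n) (BigRing ℓ n)) :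
    A.pairing (Weights n) θ A.universalForm =
      ∑ i, algebraMap (BigRing ℓ n) (A.Loc (Weights n))
        (MvPolynomial.C (MvPolynomial.X i) * θ (A.poly (Weights n) i)) *
          A.invPoly (Weights n) i := by
  have key : ∀ (z : A.Loc (Weights n)) (η : Ω[A.Loc (Weights n)⁄Weights n]),
      A.pairing (Weights n) θ (z • η) = z * A.pairing (Weights n) θ η := fun z η =>
    ((A.pairing (Weights n) θ).extendScalarsOfIsLocalization
      (Submonoid.powers (A.definingPoly (Weights n))) (A.Loc (Weights n))).map_smul z η
  rw [universalForm, map_sum]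
  refine Finset.sum_congr rfl fun i _ => ?_
  rw [LinearMap.map_smul_of_tower, key, pairing_D, map_mul, Algebra.smul_def,
    IsScalarTower.algebraMap_apply (Weights n) (BigRing ℓ n) (A.Loc (Weights n)),
    MvPolynomial.algebraMap_eq]
  ring

/-- The logarithmic ideal `I(A)` of critical sets: the ideal of `S` generated by the elements
`⟨θ, ω_a⟩` for `θ` a logarithmic derivation of `S` over `ℂ[a_1, …, a_n]`.
(These elements of `S_Q` lie in `S`, because `θ(f_i) ∈ (f_i)` for such `θ`.) -/
def logIdeal : Ideal (BigRing ℓ n) :=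
  Ideal.span {s | ∃ θ ∈ A.logDer (Weights n),
    algebraMap (BigRing ℓ n) (A.Loc (Weights n)) s = A.pairing (Weights n) θ A.universalForm}

/-- The arrangement is free: `Der_ℂ(A)` is a free module over `R = ℂ[x_1, …, x_ℓ]`. -/
def IsFree : Prop :=
  Module.Free (MvPolynomial (Fin ℓ) ℂ) (A.logDer ℂ)

end CentralArrangement

/-- An ideal (of a Cohen-Macaulay ring) is a complete intersection if it can be generated by as
many elements as its codimension (height). The unit ideal has height `⊤`, so it is excluded. -/
def Ideal.IsCompleteIntersection {T : Type*} [CommRing T] (I : Ideal T) : Prop :=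
  ∃ (r : ℕ) (g : Fin r → T), I.height = r ∧ Ideal.span (Set.range g) = I

end

/-!
Write `R = ℂ[x]` and regard `S` as the polynomial ring `R[a]`. For a logarithmic vector field
`θ ∈ Der_ℂ(A)` each `f_i` divides `θ(f_i)`, because the `f_i` are pairwise non-associated primes.
Expanding a logarithmic derivation of `S` in monomials in the weights shows that the logarithmic
ideal `I` is generated by the forms `∑ i, (θ(f_i) / f_i) a_i`, linear in `a`, with
`θ ∈ Der_ℂ(A)` (`map_logIdeal`).

The height of `I` is always `ℓ` (`height_logIdeal`). After inverting `Q` the ideal is generated by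
the `ℓ` elements that come from the fields `Q ∂_j`, so Krull's height theorem gives `≤`.
Conversely let `P ⊇ I` be prime, let `p = P ∩ R`, and let `W` be the span of the `f_i` lying in `p`,
of dimension `r`. Then `p` contains `r` independent linear forms in `x`. For `v` in the common kernel of `W`, the constant field `∂_v`
becomes logarithmic after multiplication by the product of the `f_i` not in `p`, and this yields
`ℓ - r` elements of `P` that are linear in `a` and independent modulo `p`. By
`MvPolynomial.height_comap_C_add_le`, which bounds the height of a prime of `B[y]` from below by
the number of independent linear forms in it, `ht P ≥ ht p + (ℓ - r) ≥ r + (ℓ - r) = ℓ`.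

If `Der_ℂ(A)` is free, a basis has at most `ℓ` elements and gives at most `ℓ = ht I` generators of
`I`. If `I` has `ℓ` generators, which need not be linear in `a`, then their linear parts in `a`
generate the degree one part of `I` over `R`, a copy of `Der_ℂ(A)`. A module with `ℓ` generators
that contains a copy of `R^ℓ` is free by Orzech's theorem
(`Module.free_of_span_range_eq_top`).
-/

noncomputable section

/-! ### Heights of primes in polynomial rings -/

theorem Polynomial.height_comap_C_le {B : Type*} [CommRing B] [IsNoetherianRing B]
    (P : Ideal (Polynomial B)) [P.IsPrime] : (P.comap Polynomial.C).height ≤ P.height := by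
  have : P.LiesOver (P.comap (Polynomial.C : B →+* Polynomial B)) := ⟨rfl⟩
  rw [Ideal.height_eq_height_add_of_liesOver_of_hasGoingDown (P.comap Polynomial.C) P]
  exact le_self_add

/-- The chain of primes below `p = P ∩ B` extends by the step `p B[X] < P`. -/
theorem Polynomial.height_comap_C_add_one_le {B : Type*} [CommRing B] [IsNoetherianRing B]
    (P : Ideal (Polynomial B)) [P.IsPrime] {y : Polynomial B} (hy : y ∈ P) {i : ℕ}
    (hi : y.coeff i ∉ P.comap Polynomial.C) :
    (P.comap Polynomial.C).height + 1 ≤ P.height := by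
  set p : Ideal B := P.comap Polynomial.C with hp
  have hle : p.map Polynomial.C ≤ P := Ideal.map_comap_le
  have hcomap : (p.map (Polynomial.C : B →+* Polynomial B)).comap Polynomial.C = p :=
    le_antisymm (Ideal.comap_mono hle) Ideal.le_comap_map
  have hlt : p.map Polynomial.C < P :=
    lt_of_le_of_ne hle fun h => hi (Ideal.mem_map_C_iff.mp (h ▸ hy) i)
  calc p.height + 1 ≤ (p.map (Polynomial.C : B →+* Polynomial B)).height + 1 := by
        gcongr
        conv_lhs => rw [← hcomap]
        exact Polynomial.height_comap_C_le _
    _ ≤ P.height := Ideal.height_add_one_le_of_lt_of_isPrime hlt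

/-- If a prime `P` of `B[y_1, …, y_m]` contains `s` linear forms that are linearly independent
modulo `p = P ∩ B`, then `ht p + s ≤ ht P`. The variables are removed one at a time: when the
coefficient of the current variable in some form is not in `p`, that form shows that
`P` is strictly larger than the extension of its contraction, and it eliminates the variable from
the other forms. -/
theorem MvPolynomial.height_comap_C_add_le {B : Type*} [CommRing B] [IsNoetherianRing B]
    {m s : ℕ} (P : Ideal (MvPolynomial (Fin m) B)) [P.IsPrime]
    (c : Fin s → Fin m → B) (hc : ∀ k, ∑ i, C (c k i) * X i ∈ P)
    (hind : ∀ d : Fin s → B, (∀ i, ∑ k, d k * c k i ∈ P.comap C) → ∀ k, d k ∈ P.comap C) :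
    (P.comap C).height + s ≤ P.height := by
  induction m generalizing s with
  | zero =>
    have hs : s = 0 := by
      by_contra h
      obtain ⟨s, rfl⟩ := Nat.exists_eq_succ_of_ne_zero h
      refine (Ideal.IsPrime.comap C (K := P)).ne_top ((Ideal.eq_top_iff_one _).mpr ?_)
      exact hind (fun _ => 1) (fun i => i.elim0) 0
    subst hs
    have e := RingEquiv.height_comap (isEmptyRingEquiv B (Fin 0)).symm P
    have : Ideal.comap (isEmptyRingEquiv B (Fin 0)).symm P = P.comap C := by
      rw [← Ideal.comap_coe]
      congr 1
    rw [this] at e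
    simp [e]
  | succ m ih =>
    let φ := (finSuccEquiv B m).toRingEquiv
    let P' : Ideal (Polynomial (MvPolynomial (Fin m) B)) := P.comap φ.symm
    have hP' : P'.height = P.height := RingEquiv.height_comap φ.symm P
    have hmem (y) : φ y ∈ P' ↔ y ∈ P := by simp [P']
    let q : Ideal (MvPolynomial (Fin m) B) := P'.comap Polynomial.C
    have hφC (b : B) : φ (C b) = Polynomial.C (C b) := (finSuccEquiv B m).commutes b
    have hqp : q.comap C = P.comap C := by
      ext b
      simp only [q, Ideal.mem_comap]
      rw [← hφC, hmem]
    have hφ (k) : φ (∑ i, C (c k i) * X i) =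
        Polynomial.C (C (c k 0)) * Polynomial.X +
          Polynomial.C (∑ i : Fin m, C (c k i.succ) * X i) := by
      simp only [Fin.sum_univ_succ, map_add, map_sum, map_mul, hφC]
      simp [φ, finSuccEquiv_X_zero, finSuccEquiv_X_succ]
    have hc' (k) := (hmem _).mpr (hc k)
    simp only [hφ] at hc'
    rw [← hqp] at hind ⊢
    rw [← hP']
    clear_value φ
    by_cases h0 : ∀ k, c k 0 ∈ q.comap C
    -- the terms in the first variable already lie in `P` and can be dropped
    · refine (ih q (fun k i => c k i.succ) (fun k => ?_) ?_).trans
        (Polynomial.height_comap_C_le P')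
      · exact (Ideal.add_mem_iff_right P' (Ideal.mul_mem_right _ _ (h0 k))).mp (hc' k)
      · intro d hd
        refine hind d (Fin.cases ?_ hd)
        exact Ideal.sum_mem _ fun k _ => Ideal.mul_mem_left _ _ (h0 k)
    · push Not at h0
      obtain ⟨k₀, hk₀⟩ := h0
      obtain _ | s := s
      · exact k₀.elim0
      have h1 : q.height + 1 ≤ P'.height := by
        refine Polynomial.height_comap_C_add_one_le P' (hc' k₀) (i := 1) ?_
        simp only [Polynomial.coeff_add, Polynomial.coeff_C_mul, Polynomial.coeff_X_one, mul_one,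
          Polynomial.coeff_C_of_ne_zero one_ne_zero, add_zero]
        exact hk₀
      -- eliminate the first variable from the other forms
      have h2 := ih q (fun k i => c k₀ 0 * c (k₀.succAbove k) i.succ -
        c (k₀.succAbove k) 0 * c k₀ i.succ) (fun k => ?_) ?_
      · calc _ = (q.comap C).height + s + 1 := by push_cast; rw [add_assoc]
          _ ≤ _ := by gcongr
          _ ≤ _ := h1
      · have := Ideal.sub_mem _
          (Ideal.mul_mem_left _ (Polynomial.C (C (c k₀ 0))) (hc' (k₀.succAbove k)))
          (Ideal.mul_mem_left _ (Polynomial.C (C (c (k₀.succAbove k) 0))) (hc' k₀))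
        change Polynomial.C _ ∈ P'
        convert this using 1
        simp only [map_sub, map_mul, sub_mul, Finset.sum_sub_distrib, mul_assoc, ← Finset.mul_sum]
        ring
      · intro d hd
        let d' : Fin (s + 1) → B := k₀.insertNth (-∑ k, d k * c (k₀.succAbove k) 0)
          (fun k => d k * c k₀ 0)
        have hd' (k) : d' (k₀.succAbove k) ∈ q.comap C := by
          refine hind d' (fun i => ?_) _
          rw [Fin.sum_univ_succAbove _ k₀]
          simp only [d', Fin.insertNth_apply_same, Fin.insertNth_apply_succAbove]
          refine Fin.cases ?_ (fun i => ?_) i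
          · convert Ideal.zero_mem _
            rw [neg_mul, Finset.sum_mul, neg_add_eq_zero]
            exact Finset.sum_congr rfl fun k _ => by ring
          · convert hd i using 1
            rw [neg_mul, Finset.sum_mul, neg_add_eq_sub, ← Finset.sum_sub_distrib]
            exact Finset.sum_congr rfl fun k _ => by ring
        intro k
        have := hd' k
        simp only [d', Fin.insertNth_apply_succAbove] at this
        exact ((Ideal.IsPrime.comap C (K := q)).mem_or_mem this).resolve_right hk₀

theorem Ideal.height_le_of_mem_minimalPrimes_span_range {T : Type*} [CommRing T]
    [IsNoetherianRing T] {r : ℕ} (g : Fin r → T) {P : Ideal T}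
    (hP : P ∈ (Ideal.span (Set.range g)).minimalPrimes) : P.height ≤ r := by
  refine (Ideal.height_le_card_of_mem_minimalPrimes_span (Set.finite_range g) hP).trans ?_
  have := Set.ncard_image_le (f := g) (Set.toFinite Set.univ)
  rw [Set.image_univ, Set.ncard_univ, Nat.card_fin] at this
  exact_mod_cast this

/-! ### Modules with few generators -/

/-- A module over a commutative ring that contains a copy of `R^ℓ` and has `r ≤ ℓ` generators is
free on those generators. -/
theorem Module.free_of_span_range_eq_top {R M : Type*} [CommRing R]
    [AddCommGroup M] [Module R M] {ℓ r : ℕ} (hr : r ≤ ℓ) (u : (Fin ℓ → R) →ₗ[R] M)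
    (hu : Function.Injective u) (w : Fin r → M) (hw : Submodule.span R (Set.range w) = ⊤) :
    Module.Free R M := by
  let f : (Fin r → R) →ₗ[R] M := Fintype.linearCombination R w
  have hf : Function.Surjective f := by
    rw [← LinearMap.range_eq_top, Fintype.range_linearCombination, hw]
  let N := LinearMap.eqLocus (f ∘ₗ LinearMap.fst R (Fin r → R) (Fin ℓ → R))
    (u ∘ₗ LinearMap.snd R (Fin r → R) (Fin ℓ → R))
  have hN (x : N) : f x.1.1 = u x.1.2 := x.2
  -- Orzech: the projection to `R^ℓ` is onto, and `N` embeds into `R^r ⊆ R^ℓ`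
  let i : N →ₗ[R] (Fin ℓ → R) := Function.ExtendByZero.linearMap R (Fin.castLE hr) ∘ₗ
    LinearMap.fst R _ _ ∘ₗ N.subtype
  have hi : Function.Injective i := by
    intro x y hxy
    have h1 : x.1.1 = y.1.1 :=
      Function.extend_injective (Fin.castLE_injective hr) (0 : Fin ℓ → R) hxy
    exact Subtype.ext (Prod.ext h1 (hu (by rw [← hN, ← hN, h1])))
  have hs : Function.Surjective (LinearMap.snd R _ _ ∘ₗ N.subtype : N →ₗ[R] (Fin ℓ → R)) := by
    intro y
    obtain ⟨x, hx⟩ := hf (u y)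
    exact ⟨⟨(x, y), hx⟩, rfl⟩
  have hinj := OrzechProperty.injective_of_surjective_of_injective i _ hi hs
  refine Module.Free.of_equiv (LinearEquiv.ofBijective f ⟨?_, hf⟩)
  rw [← LinearMap.ker_eq_bot, LinearMap.ker_eq_bot']
  intro x hx
  have : (⟨(x, 0), by
    rw [LinearMap.mem_eqLocus]
    simpa using hx⟩ : N) = 0 := hinj rfl
  exact congrArg (fun z : N => z.1.1) this

/-! ### Linear forms and linear parts -/

/-- The polynomial `∑ i, h_i a_i` in `B[a_1, …, a_n]`, as a function of its coefficient vector. -/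
def MvPolynomial.linearForm (B : Type*) [CommRing B] (n : ℕ) :
    (Fin n → B) →ₗ[B] MvPolynomial (Fin n) B :=
  Fintype.linearCombination B X

theorem MvPolynomial.linearForm_apply {B : Type*} [CommRing B] {n : ℕ} (h : Fin n → B) :
    linearForm B n h = ∑ i, C (h i) * X i := by
  simp [linearForm, Fintype.linearCombination_apply, smul_eq_C_mul]

/-- The coefficients of the linear part of a polynomial. -/
def MvPolynomial.linearPart (B : Type*) [CommRing B] (n : ℕ) :
    MvPolynomial (Fin n) B →ₗ[B] (Fin n → B) :=
  LinearMap.pi fun i => (aeval (0 : Fin n → B)).toLinearMap ∘ₗ (pderiv i).toLinearMap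

theorem MvPolynomial.linearPart_mul {B : Type*} [CommRing B] {n : ℕ}
    (s t : MvPolynomial (Fin n) B) :
    linearPart B n (s * t) =
      aeval (0 : Fin n → B) s • linearPart B n t + aeval (0 : Fin n → B) t • linearPart B n s := by
  ext1 i
  simp [linearPart]

theorem MvPolynomial.linearPart_linearForm {B : Type*} [CommRing B] {n : ℕ} (h : Fin n → B) :
    linearPart B n (linearForm B n h) = h := by
  ext1 i
  simp [linearPart, linearForm_apply, pderiv_X, Pi.single_apply, apply_ite]

theorem MvPolynomial.aeval_zero_linearForm {B : Type*} [CommRing B] {n : ℕ} (h : Fin n → B) :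
    aeval (0 : Fin n → B) (linearForm B n h) = 0 := by
  simp [linearForm_apply]

/-- If the `g k` have no constant term, the linear part of `∑ k, c_k g_k` only involves the constant
terms of the `c_k`. -/
theorem MvPolynomial.linearPart_mem_span {B : Type*} [CommRing B] {n r : ℕ}
    {g : Fin r → MvPolynomial (Fin n) B}
    (hg : ∀ k, aeval (0 : Fin n → B) (g k) = 0) {t : MvPolynomial (Fin n) B}
    (ht : t ∈ Ideal.span (Set.range g)) :
    linearPart B n t ∈ Submodule.span B (Set.range fun k => linearPart B n (g k)) := by
  obtain ⟨c, rfl⟩ := (Ideal.mem_span_range_iff_exists_fun).mp ht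
  rw [map_sum]
  refine Submodule.sum_mem _ fun k _ => ?_
  rw [linearPart_mul, hg, zero_smul, add_zero]
  exact Submodule.smul_mem _ _ (Submodule.subset_span ⟨k, rfl⟩)

/-! ### Logarithmic vector fields -/

theorem Derivation.leibniz_finset_prod {k T ι : Type*} [CommRing k] [CommRing T] [Algebra k T]
    [DecidableEq ι] (θ : Derivation k T T) (s : Finset ι) (f : ι → T) :
    θ (∏ i ∈ s, f i) = ∑ i ∈ s, (∏ j ∈ s.erase i, f j) * θ (f i) := by
  induction s using Finset.induction_on with
  | empty => simp
  | insert a s ha ih =>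
    rw [Finset.prod_insert ha, Derivation.leibniz, ih, Finset.sum_insert ha,
      Finset.erase_insert ha, add_comm, smul_eq_mul, smul_eq_mul, Finset.mul_sum]
    congr 1
    refine Finset.sum_congr rfl fun i hi => ?_
    have hia : a ≠ i := fun h => ha (h ▸ hi)
    rw [Finset.erase_insert_of_ne hia, Finset.prod_insert fun h => ha (Finset.mem_of_mem_erase h),
      mul_assoc]

theorem Module.Dual.apply_eq_sum_single {ℓ : ℕ} (φ : Module.Dual ℂ (Fin ℓ → ℂ)) (v : Fin ℓ → ℂ) :
    φ v = ∑ j, v j * φ (Pi.single j 1) := by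
  conv_lhs => rw [pi_eq_sum_univ' v]
  simp

namespace CentralArrangement

open MvPolynomial

variable {ℓ n : ℕ} (A : CentralArrangement ℓ n)

section Coefficients

variable (k : Type) [CommRing k] [Algebra ℂ k]

theorem eval_poly (v : Fin ℓ → ℂ) (i : Fin n) :
    eval (fun j => algebraMap ℂ k (v j)) (A.poly k i) = algebraMap ℂ k (A.form i v) := by
  rw [Module.Dual.apply_eq_sum_single]
  simp [poly, mul_comm]

theorem derivation_poly
    (θ : Derivation k (MvPolynomial (Fin ℓ) k) (MvPolynomial (Fin ℓ) k)) (i : Fin n) :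
    θ (A.poly k i) = ∑ j, C (algebraMap ℂ k (A.form i (Pi.single j 1))) * θ (X j) := by
  simp [poly]

variable [IsDomain k]

/-- Divisibility of the forms gives an inclusion of hyperplanes, by evaluation at complex points. -/
theorem eq_of_poly_dvd {i j : Fin n} (h : A.poly k i ∣ A.poly k j) : i = j := by
  have hle : LinearMap.ker (A.form i) ≤ LinearMap.ker (A.form j) := fun v hv => by
    have := map_dvd (eval fun m => algebraMap ℂ k (v m)) h
    rw [eval_poly, eval_poly, LinearMap.mem_ker.mp hv, map_zero, zero_dvd_iff] at this
    exact (FaithfulSMul.algebraMap_eq_zero_iff ℂ k).mp this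
  refine A.ker_injective (Submodule.eq_of_le_of_finrank_eq hle ?_)
  have h1 := Module.Dual.finrank_ker_add_one_of_ne_zero (A.form_ne_zero i)
  have h2 := Module.Dual.finrank_ker_add_one_of_ne_zero (A.form_ne_zero j)
  exact Nat.add_right_cancel (h1.trans h2.symm)

theorem exists_form_single_ne_zero (i : Fin n) : ∃ j, A.form i (Pi.single j 1) ≠ 0 := by
  by_contra! h
  refine A.form_ne_zero i (LinearMap.pi_ext' fun j => LinearMap.ext_ring ?_)
  simpa using h j

theorem poly_prime [UniqueFactorizationMonoid k] (i : Fin n) : Prime (A.poly k i) := by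
  obtain ⟨j, hj⟩ := A.exists_form_single_ne_zero i
  let c : Fin ℓ →₀ k :=
    Finsupp.equivFunOnFinite.symm fun j => algebraMap ℂ k (A.form i (Pi.single j 1))
  have hc : A.poly k i = sumSMulX c := by
    simp [sumSMulX, Finsupp.linearCombination_apply, Finsupp.sum_fintype, poly, c, smul_eq_C_mul]
  have hu : IsUnit (c j) := (isUnit_iff_ne_zero.mpr hj).map (algebraMap ℂ k)
  rw [hc]
  refine (irreducible_sumSMulX c ⟨j, ?_⟩ fun r hr => isUnit_of_dvd_unit (hr j) hu).prime
  exact Finsupp.mem_support_iff.mpr hu.ne_zero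

/-- A derivation is logarithmic along the arrangement if and only if it is logarithmic along each
hyperplane. -/
theorem mem_logDer_iff [UniqueFactorizationMonoid k]
    (θ : Derivation k (MvPolynomial (Fin ℓ) k) (MvPolynomial (Fin ℓ) k)) :
    θ ∈ A.logDer k ↔ ∀ i, A.poly k i ∣ θ (A.poly k i) := by
  have hQ : θ (A.definingPoly k) =
      ∑ i, (∏ j ∈ Finset.univ.erase i, A.poly k j) * θ (A.poly k i) := by
    rw [definingPoly, Derivation.leibniz_finset_prod]
  change θ (A.definingPoly k) ∈ Ideal.span {A.definingPoly k} ↔ _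
  rw [Ideal.mem_span_singleton, hQ]
  constructor
  · intro h i
    have h1 := (Finset.dvd_prod_of_mem (A.poly k) (Finset.mem_univ i)).trans h
    rw [← Finset.add_sum_erase _ _ (Finset.mem_univ i)] at h1
    refine ((A.poly_prime k i).dvd_or_dvd
      ((dvd_add_left (Finset.dvd_sum fun m hm => ?_)).mp h1)).resolve_left fun h3 => ?_
    · refine dvd_mul_of_dvd_left (Finset.dvd_prod_of_mem (A.poly k) ?_) _
      exact Finset.mem_erase.mpr ⟨(Finset.ne_of_mem_erase hm).symm, Finset.mem_univ _⟩
    · obtain ⟨m, hm, h4⟩ := (A.poly_prime k i).exists_mem_finset_dvd h3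
      exact Finset.ne_of_mem_erase hm (A.eq_of_poly_dvd k h4).symm
  · intro h
    refine Finset.dvd_sum fun i _ => ?_
    rw [definingPoly, ← Finset.prod_erase_mul _ _ (Finset.mem_univ i)]
    exact mul_dvd_mul_left _ (h i)

end Coefficients

/-- The logarithmic vector field `θ` sent to the tuple of quotients `θ(f_i) / f_i`. -/
def logQuot : A.logDer ℂ →ₗ[MvPolynomial (Fin ℓ) ℂ] (Fin n → MvPolynomial (Fin ℓ) ℂ) where
  toFun θ i := ((A.mem_logDer_iff ℂ θ).mp θ.2 i).choose
  map_add' θ η := by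
    funext i
    refine mul_left_cancel₀ (A.poly_prime ℂ i).ne_zero ?_
    rw [Pi.add_apply, mul_add]
    iterate 3 rw [← ((A.mem_logDer_iff ℂ _).mp (Subtype.prop _) i).choose_spec]
    rfl
  map_smul' c θ := by
    funext i
    refine mul_left_cancel₀ (A.poly_prime ℂ i).ne_zero ?_
    rw [RingHom.id_apply, Pi.smul_apply, smul_eq_mul, mul_left_comm]
    iterate 2 rw [← ((A.mem_logDer_iff ℂ _).mp (Subtype.prop _) i).choose_spec]
    rfl

theorem poly_mul_logQuot (θ : A.logDer ℂ) (i : Fin n) :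
    A.poly ℂ i * A.logQuot θ i = θ.1 (A.poly ℂ i) :=
  ((A.mem_logDer_iff ℂ θ).mp θ.2 i).choose_spec.symm

theorem logQuot_eq_of_mul_eq {θ : A.logDer ℂ} {i : Fin n} {h : MvPolynomial (Fin ℓ) ℂ}
    (hh : θ.1 (A.poly ℂ i) = A.poly ℂ i * h) : A.logQuot θ i = h :=
  mul_left_cancel₀ (A.poly_prime ℂ i).ne_zero (by rw [poly_mul_logQuot, hh])

variable {A} in
theorem IsEssential.span_form (hA : A.IsEssential) :
    Submodule.span ℂ (Set.range A.form) = ⊤ := by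
  obtain ⟨e, he⟩ := hA
  rw [eq_top_iff, ← he.span_eq_top_of_card_eq_finrank' (by simp [Subspace.dual_finrank_eq])]
  exact Submodule.span_mono (Set.range_comp_subset_range e A.form)

/-- A logarithmic vector field of an essential arrangement is determined by the quotients
`θ(f_i) / f_i`, because the forms `f_i` span all linear forms. -/
theorem logQuot_injective (hA : A.IsEssential) : Function.Injective A.logQuot := by
  refine (LinearMap.ker_eq_bot (R := MvPolynomial (Fin ℓ) ℂ) (M := A.logDer ℂ)
    (f := A.logQuot)).mp (LinearMap.ker_eq_bot'.mpr fun θ hθ => ?_)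
  have key (φ : Module.Dual ℂ (Fin ℓ → ℂ)) : ∑ j, C (φ (Pi.single j 1)) * θ.1 (X j) = 0 := by
    have hφ : φ ∈ Submodule.span ℂ (Set.range A.form) := hA.span_form ▸ Submodule.mem_top
    induction hφ using Submodule.span_induction with
    | mem φ h =>
      obtain ⟨i, rfl⟩ := h
      have := A.derivation_poly ℂ θ.1 i
      rw [← poly_mul_logQuot, hθ] at this
      simpa using this.symm
    | zero => simp
    | add φ ψ _ _ h1 h2 => simp [add_mul, Finset.sum_add_distrib, h1, h2]
    | smul c φ _ h => simp [mul_assoc, ← Finset.mul_sum, h]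
  refine Subtype.ext (MvPolynomial.derivation_ext fun m => ?_)
  simpa [Pi.single_apply, Finset.sum_ite_eq] using key (LinearMap.proj m)

/-- The vector field `u ∂_v` with polynomial coefficient `u` and constant direction `v`. -/
def constField (u : MvPolynomial (Fin ℓ) ℂ) (v : Fin ℓ → ℂ) :
    Derivation ℂ (MvPolynomial (Fin ℓ) ℂ) (MvPolynomial (Fin ℓ) ℂ) :=
  u • mkDerivation ℂ fun j => C (v j)

theorem constField_poly (u : MvPolynomial (Fin ℓ) ℂ) (v : Fin ℓ → ℂ) (i : Fin n) :
    constField u v (A.poly ℂ i) = u * C (A.form i v) := by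
  rw [derivation_poly, Module.Dual.apply_eq_sum_single]
  simp only [constField, Derivation.smul_apply, mkDerivation_X, smul_eq_mul, map_sum, map_mul,
    Finset.mul_sum, Algebra.algebraMap_self, RingHom.id_apply]
  exact Finset.sum_congr rfl fun j _ => by ring

/-! ### Generators of the logarithmic ideal -/

/-- The logarithmic ideal rewritten in `ℂ[x][a]`: it is generated by the forms
`∑ i, (θ(f_i) / f_i) a_i`, which are linear in the weights `a_i`, for `θ ∈ Der_ℂ(A)`. -/
def linearIdeal : Ideal (MvPolynomial (Fin n) (MvPolynomial (Fin ℓ) ℂ)) :=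
  Ideal.span (Set.range fun θ => linearForm _ n (A.logQuot θ))

theorem commAlgEquiv_poly (i : Fin n) :
    commAlgEquiv ℂ (Fin ℓ) (Fin n) (A.poly (Weights n) i) = C (A.poly ℂ i) := by
  simp [poly, MvPolynomial.algebraMap_eq]

theorem commAlgEquiv_derivation_poly (θ : Derivation (Weights n) (BigRing ℓ n) (BigRing ℓ n))
    (i : Fin n) :
    commAlgEquiv ℂ (Fin ℓ) (Fin n) (θ (A.poly (Weights n) i)) =
      ∑ j, C (C (A.form i (Pi.single j 1))) * commAlgEquiv ℂ (Fin ℓ) (Fin n) (θ (X j)) := by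
  rw [derivation_poly, map_sum]
  simp [MvPolynomial.algebraMap_eq]

/-- The element of `S` that `⟨θ, ω_a⟩` equals, in terms of the quotients `h i = θ(f_i) / f_i`. -/
theorem pairing_universalForm_eq {θ : Derivation (Weights n) (BigRing ℓ n) (BigRing ℓ n)}
    {h : Fin n → BigRing ℓ n}
    (hh : ∀ i, θ (A.poly (Weights n) i) = A.poly (Weights n) i * h i) :
    A.pairing (Weights n) θ A.universalForm =
      algebraMap (BigRing ℓ n) (A.Loc (Weights n)) (∑ i, C (X i) * h i) := by
  rw [pairing_universalForm, map_sum]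
  refine Finset.sum_congr rfl fun i _ => ?_
  have hu : algebraMap (BigRing ℓ n) (A.Loc (Weights n)) (A.poly (Weights n) i) *
      A.invPoly (Weights n) i = 1 := (A.isUnit_poly (Weights n) i).mul_val_inv
  rw [hh, map_mul, map_mul, map_mul]
  linear_combination (algebraMap (BigRing ℓ n) (A.Loc (Weights n)) (C (X i)) *
    algebraMap (BigRing ℓ n) (A.Loc (Weights n)) (h i)) * hu

theorem definingPoly_ne_zero (k : Type) [CommRing k] [Algebra ℂ k] [IsDomain k]
    [UniqueFactorizationMonoid k] : A.definingPoly k ≠ 0 :=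
  Finset.prod_ne_zero_iff.mpr fun i _ => (A.poly_prime k i).ne_zero

theorem algebraMap_loc_injective :
    Function.Injective (algebraMap (BigRing ℓ n) (A.Loc (Weights n))) :=
  IsLocalization.injective (A.Loc (Weights n))
    (powers_le_nonZeroDivisors_of_noZeroDivisors (A.definingPoly_ne_zero (Weights n)))

theorem commAlgEquiv_mem_linearIdeal {s : BigRing ℓ n}
    {θ : Derivation (Weights n) (BigRing ℓ n) (BigRing ℓ n)} (hθ : θ ∈ A.logDer (Weights n))
    (hs : algebraMap (BigRing ℓ n) (A.Loc (Weights n)) s =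
      A.pairing (Weights n) θ A.universalForm) :
    commAlgEquiv ℂ (Fin ℓ) (Fin n) s ∈ A.linearIdeal := by
  choose h hh using (A.mem_logDer_iff (Weights n) θ).mp hθ
  rw [A.pairing_universalForm_eq hh] at hs
  rw [A.algebraMap_loc_injective hs]
  set Φ := commAlgEquiv ℂ (Fin ℓ) (Fin n) with hΦ
  -- the coefficient of `a ^ m` in `θ` is a logarithmic vector field over `ℂ`
  let η (m : Fin n →₀ ℕ) : Derivation ℂ (MvPolynomial (Fin ℓ) ℂ) (MvPolynomial (Fin ℓ) ℂ) :=
    mkDerivation ℂ fun j => coeff m (Φ (θ (X j)))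
  have hη (m i) : η m (A.poly ℂ i) = A.poly ℂ i * coeff m (Φ (h i)) := by
    rw [← coeff_C_mul, ← commAlgEquiv_poly, ← map_mul, ← hh, commAlgEquiv_derivation_poly,
      derivation_poly, coeff_sum]
    simp [η, mkDerivation_X, hΦ, coeff_C_mul]
  have hη' (m) : η m ∈ A.logDer ℂ := (A.mem_logDer_iff ℂ _).mpr fun i => ⟨_, hη m i⟩
  have hq (m i) : A.logQuot ⟨η m, hη' m⟩ i = coeff m (Φ (h i)) := A.logQuot_eq_of_mul_eq (hη m i)
  let F : Finset (Fin n →₀ ℕ) := Finset.univ.biUnion fun i => (Φ (h i)).support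
  have hF (i) : Φ (h i) = ∑ m ∈ F, monomial m (coeff m (Φ (h i))) := by
    conv_lhs => rw [(Φ (h i)).as_sum]
    refine Finset.sum_subset (Finset.subset_biUnion_of_mem
      (fun i => (Φ (h i)).support) (Finset.mem_univ i)) fun m _ hm => ?_
    rw [notMem_support_iff.mp hm, monomial_zero]
  have key : Φ (∑ i, C (X i) * h i) =
      ∑ m ∈ F, monomial m 1 * linearForm _ n (A.logQuot ⟨η m, hη' m⟩) := by
    simp only [linearForm_apply, hq, Finset.mul_sum]
    rw [Finset.sum_comm, map_sum]
    refine Finset.sum_congr rfl fun i _ => ?_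
    rw [map_mul, hΦ, commAlgEquiv_C_X, ← hΦ]
    refine (congrArg (X i * ·) (hF i)).trans ?_
    rw [Finset.mul_sum]
    refine Finset.sum_congr rfl fun m _ => ?_
    conv_lhs => rw [← mul_one (coeff m _), ← C_mul_monomial]
    ring
  rw [key]
  exact Ideal.sum_mem _ fun m _ => Ideal.mul_mem_left _ _ (Ideal.subset_span ⟨_, rfl⟩)

/-- Extension of scalars of a logarithmic vector field from `ℂ` to `ℂ[a]`. -/
theorem exists_mem_logDer_pairing_eq (θ : A.logDer ℂ) :
    ∃ η ∈ A.logDer (Weights n), A.pairing (Weights n) η A.universalForm =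
      algebraMap (BigRing ℓ n) (A.Loc (Weights n))
        ((commAlgEquiv ℂ (Fin ℓ) (Fin n)).symm (linearForm _ n (A.logQuot θ))) := by
  set Φ := commAlgEquiv ℂ (Fin ℓ) (Fin n) with hΦ
  let η : Derivation (Weights n) (BigRing ℓ n) (BigRing ℓ n) :=
    mkDerivation (Weights n) fun j => Φ.symm (C (θ.1 (X j)))
  have hη (i) : η (A.poly (Weights n) i) =
      A.poly (Weights n) i * Φ.symm (C (A.logQuot θ i)) := by
    refine Φ.injective ?_
    rw [map_mul, hΦ, commAlgEquiv_poly, commAlgEquiv_derivation_poly, ← hΦ, Φ.apply_symm_apply,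
      ← C_mul, poly_mul_logQuot, derivation_poly]
    simp [η, mkDerivation_X]
  refine ⟨η, (A.mem_logDer_iff _ _).mpr fun i => ⟨_, hη i⟩, ?_⟩
  rw [A.pairing_universalForm_eq hη]
  congr 1
  refine Φ.injective ?_
  rw [Φ.apply_symm_apply, linearForm_apply, map_sum]
  refine Finset.sum_congr rfl fun i _ => ?_
  rw [map_mul, Φ.apply_symm_apply, hΦ, commAlgEquiv_C_X, mul_comm]

/-- The logarithmic ideal corresponds to `linearIdeal` under `ℂ[a][x] ≃ ℂ[x][a]`. -/
theorem map_logIdeal :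
    A.logIdeal.map (commAlgEquiv ℂ (Fin ℓ) (Fin n)).toRingEquiv = A.linearIdeal := by
  rw [logIdeal, Ideal.map_span]
  refine le_antisymm (Ideal.span_le.mpr ?_) (Ideal.span_le.mpr ?_)
  · rintro _ ⟨s, ⟨θ, hθ, hs⟩, rfl⟩
    exact A.commAlgEquiv_mem_linearIdeal hθ hs
  · rintro _ ⟨θ, rfl⟩
    obtain ⟨η, hη, h⟩ := A.exists_mem_logDer_pairing_eq θ
    exact Ideal.subset_span ⟨_, ⟨η, hη, h.symm⟩, AlgEquiv.apply_symm_apply _ _⟩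

theorem linearIdeal_le_ker_aeval_zero :
    A.linearIdeal ≤ RingHom.ker (aeval (0 : Fin n → MvPolynomial (Fin ℓ) ℂ)) := by
  refine Ideal.span_le.mpr ?_
  rintro _ ⟨θ, rfl⟩
  exact aeval_zero_linearForm _

theorem linearIdeal_ne_top : A.linearIdeal ≠ ⊤ := fun h =>
  RingHom.ker_ne_top _ (top_le_iff.mp (h ▸ A.linearIdeal_le_ker_aeval_zero))

/-! ### The height of the logarithmic ideal -/

/-- The logarithmic vector field `Q ∂_j`. -/
def scaledField (j : Fin ℓ) : A.logDer ℂ :=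
  ⟨constField (A.definingPoly ℂ) (Pi.single j 1), (A.mem_logDer_iff ℂ _).mpr fun i => by
    rw [constField_poly]
    exact dvd_mul_of_dvd_left (Finset.dvd_prod_of_mem _ (Finset.mem_univ i)) _⟩

theorem sum_smul_scaledField_apply_X (c : Fin ℓ → MvPolynomial (Fin ℓ) ℂ) (m : Fin ℓ) :
    (∑ j, c j • A.scaledField j).1 (X m) = c m * A.definingPoly ℂ := by
  have hsum (f : Fin ℓ → A.logDer ℂ) : (∑ j, f j).1 (X m) = ∑ j, (f j).1 (X m) := by
    rw [Submodule.coe_sum]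
    exact map_sum ((Pi.evalAddMonoidHom _ (X m)).comp Derivation.coeFnAddMonoidHom) _ _
  have hX (j) : (A.scaledField j).1 (X m) = if m = j then A.definingPoly ℂ else 0 := by
    change constField _ _ _ = _
    rw [constField, Derivation.smul_apply, mkDerivation_X, Pi.single_apply]
    split_ifs <;> simp
  rw [hsum]
  change ∑ j, c j * (A.scaledField j).1 (X m) = _
  simp only [hX, mul_ite, mul_zero, Finset.sum_ite_eq, Finset.mem_univ, if_true]

theorem linearCombination_scaledField_injective :
    Function.Injective
      (Fintype.linearCombination (MvPolynomial (Fin ℓ) ℂ) A.scaledField) := by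
  intro c d h
  funext m
  refine mul_right_cancel₀ (A.definingPoly_ne_zero ℂ) ?_
  rw [← sum_smul_scaledField_apply_X, ← sum_smul_scaledField_apply_X]
  exact congrArg (fun θ : A.logDer ℂ => θ.1 (X m)) h

theorem definingPoly_smul_eq_sum (θ : A.logDer ℂ) :
    A.definingPoly ℂ • θ = ∑ j, θ.1 (X j) • A.scaledField j := by
  refine Subtype.ext (MvPolynomial.derivation_ext fun m => ?_)
  rw [sum_smul_scaledField_apply_X]
  exact mul_comm _ _

/-- Away from `Q = 0` the module of logarithmic vector fields is generated by the `ℓ` fields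
`Q ∂_j`. Hence the ideal lies in a prime that does not contain `Q` and is minimal over `ℓ`
elements, and Krull's height theorem applies to that prime. -/
theorem height_linearIdeal_le : A.linearIdeal.height ≤ ℓ := by
  let g (j : Fin ℓ) := linearForm _ n (A.logQuot (A.scaledField j))
  let K := RingHom.ker (aeval (R := MvPolynomial (Fin ℓ) ℂ) (0 : Fin n → MvPolynomial (Fin ℓ) ℂ))
  have hK : K.IsPrime := RingHom.ker_isPrime _
  have hgK : Ideal.span (Set.range g) ≤ K := by
    refine Ideal.span_le.mpr ?_
    rintro _ ⟨j, rfl⟩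
    exact aeval_zero_linearForm _
  -- a minimal prime inside `K` avoids `Q`, because `K` does
  obtain ⟨P, hP, hPK⟩ := Ideal.exists_minimalPrimes_le hgK
  have hPp : P.IsPrime := hP.1.1
  have hQ : C (A.definingPoly ℂ) ∉ P := fun h => by
    have := hPK h
    simp only [K, RingHom.mem_ker] at this
    rw [aeval_C] at this
    exact A.definingPoly_ne_zero ℂ this
  have hle : A.linearIdeal ≤ P := by
    refine Ideal.span_le.mpr ?_
    rintro _ ⟨θ, rfl⟩
    refine (hPp.mem_or_mem (?_ : C (A.definingPoly ℂ) * _ ∈ P)).resolve_left hQ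
    have : C (A.definingPoly ℂ) * linearForm _ n (A.logQuot θ) = ∑ j, C (θ.1 (X j)) * g j := by
      simp only [← smul_eq_C_mul, g, ← map_smul, ← map_sum]
      rw [definingPoly_smul_eq_sum]
    rw [this]
    exact Ideal.sum_mem _ fun j _ => Ideal.mul_mem_left _ _ (hP.1.2 (Ideal.subset_span ⟨j, rfl⟩))
  exact (Ideal.height_mono hle).trans (Ideal.height_le_of_mem_minimalPrimes_span_range g hP)

theorem finrank_le_height_of_linear_mem {p : Ideal (MvPolynomial (Fin ℓ) ℂ)} [p.IsPrime]
    (W : Submodule ℂ (Module.Dual ℂ (Fin ℓ → ℂ)))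
    (hW : ∀ φ ∈ W, ∑ j, C (φ (Pi.single j 1)) * X j ∈ p) :
    (Module.finrank ℂ W : ℕ∞) ≤ p.height := by
  let b := Module.finBasis ℂ W
  have hbot : p.comap C = ⊥ :=
    (Ideal.eq_bot_or_top _).resolve_right (Ideal.IsPrime.comap C (K := p)).ne_top
  refine le_trans le_add_self (MvPolynomial.height_comap_C_add_le p
    (fun k j => (b k).1 (Pi.single j 1)) (fun k => hW _ (b k).2) fun d hd => ?_)
  simp only [hbot, Ideal.mem_bot] at hd ⊢
  refine Fintype.linearIndependent_iff.mp b.linearIndependent d (Subtype.ext ?_)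
  refine LinearMap.ext fun v => ?_
  rw [Module.Dual.apply_eq_sum_single]
  refine Finset.sum_eq_zero fun j _ => ?_
  rw [Submodule.coe_sum, LinearMap.sum_apply]
  simpa using Or.inr (hd j)

/-- A prime `P` over the logarithmic ideal has height at least `ℓ`: the forms `f_i ∈ P` and the
constant fields along their common kernel together contribute `ℓ` independent linear elements. -/
theorem le_height_of_isPrime (hA : A.IsEssential)
    (P : Ideal (MvPolynomial (Fin n) (MvPolynomial (Fin ℓ) ℂ))) [P.IsPrime]
    (hP : ∀ θ, linearForm _ n (A.logQuot θ) ∈ P) : ℓ ≤ P.height := by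
  classical
  let p : Ideal (MvPolynomial (Fin ℓ) ℂ) := P.comap C
  let W : Submodule ℂ (Module.Dual ℂ (Fin ℓ → ℂ)) :=
    Submodule.span ℂ (A.form '' {i | A.poly ℂ i ∈ p})
  have hW : (Module.finrank ℂ W : ℕ∞) ≤ p.height := by
    refine finrank_le_height_of_linear_mem W fun φ hφ => ?_
    induction hφ using Submodule.span_induction with
    | mem φ h =>
      obtain ⟨i, hi, rfl⟩ := h
      simpa [poly] using hi
    | zero => simp
    | add φ ψ _ _ h1 h2 =>
      simpa [add_mul, Finset.sum_add_distrib] using Ideal.add_mem _ h1 h2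
    | smul c φ _ h =>
      simpa [mul_assoc, ← Finset.mul_sum] using Ideal.mul_mem_left _ (C c) h
  -- the constant vector fields tangent to every hyperplane through the generic point of `p`
  let U : Submodule ℂ (Fin ℓ → ℂ) := W.dualCoannihilator
  let v := Module.finBasis ℂ U
  let G : Finset (Fin n) := {i | A.poly ℂ i ∉ p}
  have hG (i) : i ∈ G ↔ A.poly ℂ i ∉ p := by simp [G]
  have hv {i} (hi : i ∉ G) (k) : A.form i (v k) = 0 :=
    (Submodule.mem_dualCoannihilator _).mp (v k).2 _
      (Submodule.subset_span ⟨i, not_not.mp (mt (hG i).mpr hi), rfl⟩)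
  let θ (k) : Derivation ℂ (MvPolynomial (Fin ℓ) ℂ) (MvPolynomial (Fin ℓ) ℂ) :=
    constField (∏ i ∈ G, A.poly ℂ i) (v k).1
  let c (k) (i : Fin n) : MvPolynomial (Fin ℓ) ℂ :=
    (∏ j ∈ G.erase i, A.poly ℂ j) * C (A.form i (v k))
  have hθ (k i) : θ k (A.poly ℂ i) = A.poly ℂ i * c k i := by
    rw [constField_poly]
    by_cases hi : i ∈ G
    · rw [← Finset.mul_prod_erase _ _ hi, mul_assoc]
    · simp [c, hv hi]
  have hθ' (k) : θ k ∈ A.logDer ℂ := (A.mem_logDer_iff ℂ _).mpr fun i => ⟨_, hθ k i⟩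
  have hind : (p.height + Module.finrank ℂ U : ℕ∞) ≤ P.height := by
    refine MvPolynomial.height_comap_C_add_le P c (fun k => ?_) fun d hd => ?_
    · convert hP ⟨θ k, hθ' k⟩ using 1
      rw [linearForm_apply]
      exact Finset.sum_congr rfl fun i _ => by rw [A.logQuot_eq_of_mul_eq (hθ k i)]
    · have hp : p.IsPrime := Ideal.IsPrime.comap C
      have key (φ : Module.Dual ℂ (Fin ℓ → ℂ)) : ∑ k, d k * C (φ (v k)) ∈ p := by
        have hφ : φ ∈ Submodule.span ℂ (Set.range A.form) := hA.span_form ▸ Submodule.mem_top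
        induction hφ using Submodule.span_induction with
        | mem φ h =>
          obtain ⟨i, rfl⟩ := h
          by_cases hi : i ∈ G
          · have h1 : (∏ j ∈ G.erase i, A.poly ℂ j) * ∑ k, d k * C (A.form i (v k)) ∈ p := by
              convert hd i using 1
              rw [Finset.mul_sum]
              exact Finset.sum_congr rfl fun k _ => mul_left_comm _ _ _
            refine (hp.mem_or_mem h1).resolve_left fun h2 => ?_
            obtain ⟨j, hj, h3⟩ := (Ideal.IsPrime.prod_mem_iff (hp := hp)).mp h2
            exact (hG j).mp (Finset.mem_of_mem_erase hj) h3
          · simp [hv hi]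
        | zero => simp
        | add φ ψ _ _ h1 h2 =>
          simpa [mul_add, Finset.sum_add_distrib] using Ideal.add_mem _ h1 h2
        | smul c φ _ h =>
          have := Ideal.mul_mem_left _ (C c) h
          rw [Finset.mul_sum] at this
          simpa [mul_left_comm] using this
      intro k
      obtain ⟨φ, hφ⟩ := LinearMap.exists_extend (v.coord k)
      have hφv (m) : φ (v m) = if m = k then 1 else 0 := by
        have := LinearMap.congr_fun hφ (v m)
        simpa [Finsupp.single_apply] using this
      exact (by simpa [hφv] using key φ : d k ∈ p)
  have hdim : Module.finrank ℂ W + Module.finrank ℂ U = ℓ := by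
    have := Subspace.finrank_add_finrank_dualCoannihilator_eq W
    rwa [Module.finrank_fin_fun] at this
  calc (ℓ : ℕ∞) = Module.finrank ℂ W + Module.finrank ℂ U := by rw [← Nat.cast_add, hdim]
    _ ≤ p.height + Module.finrank ℂ U := by gcongr
    _ ≤ P.height := hind

theorem le_height_linearIdeal (hA : A.IsEssential) : ℓ ≤ A.linearIdeal.height := by
  rw [Ideal.height_eq_inf_minimalPrimes]
  refine le_iInf₂ fun P hP => ?_
  have := hP.1.1
  exact A.le_height_of_isPrime hA P fun θ => hP.1.2 (Ideal.subset_span ⟨θ, rfl⟩)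

theorem height_logIdeal (hA : A.IsEssential) : A.logIdeal.height = ℓ := by
  rw [← RingEquiv.height_map (commAlgEquiv ℂ (Fin ℓ) (Fin n)).toRingEquiv, map_logIdeal]
  exact le_antisymm A.height_linearIdeal_le (A.le_height_linearIdeal hA)

/-! ### Freeness and the number of generators -/

/-- The elements of degree one in `a` of the ideal are the generators `∑ i, (θ(f_i) / f_i) a_i`
themselves. -/
theorem linearPart_mem_range_logQuot {t : MvPolynomial (Fin n) (MvPolynomial (Fin ℓ) ℂ)}
    (ht : t ∈ A.linearIdeal) : linearPart _ n t ∈ LinearMap.range A.logQuot := by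
  induction ht using Submodule.span_induction with
  | mem t h =>
    obtain ⟨θ, rfl⟩ := h
    exact ⟨θ, (linearPart_linearForm _).symm⟩
  | zero => rw [map_zero]; exact zero_mem _
  | add s t _ _ h1 h2 => rw [map_add]; exact add_mem h1 h2
  | smul s t ht h =>
    have h0 : aeval (0 : Fin n → MvPolynomial (Fin ℓ) ℂ) t = 0 :=
      A.linearIdeal_le_ker_aeval_zero ht
    rw [smul_eq_mul, linearPart_mul, h0, zero_smul, add_zero]
    exact Submodule.smul_mem _ _ h

/-- The linear parts of the `g k` generate a module isomorphic to `Der_ℂ(A)`, which also contains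
the copy of `R^ℓ` spanned by the fields `Q ∂_j`. -/
theorem isFree_of_span_eq_linearIdeal (hA : A.IsEssential) {r : ℕ} (hr : r ≤ ℓ)
    (g : Fin r → MvPolynomial (Fin n) (MvPolynomial (Fin ℓ) ℂ))
    (hg : Ideal.span (Set.range g) = A.linearIdeal) : A.IsFree := by
  have hgI (k) : g k ∈ A.linearIdeal := hg ▸ Ideal.subset_span ⟨k, rfl⟩
  have hg0 (k) : aeval (0 : Fin n → MvPolynomial (Fin ℓ) ℂ) (g k) = 0 :=
    A.linearIdeal_le_ker_aeval_zero (hgI k)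
  choose w hw using fun k => A.linearPart_mem_range_logQuot (hgI k)
  refine Module.free_of_span_range_eq_top hr
    _ A.linearCombination_scaledField_injective w (eq_top_iff.mpr fun θ _ => ?_)
  have h1 : A.logQuot θ ∈ Submodule.span (MvPolynomial (Fin ℓ) ℂ)
      (Set.range fun k => linearPart _ n (g k)) := by
    rw [← linearPart_linearForm (A.logQuot θ)]
    exact MvPolynomial.linearPart_mem_span hg0 (hg ▸ Ideal.subset_span ⟨θ, rfl⟩)
  have h2 : (Set.range fun k => linearPart _ n (g k)) = A.logQuot '' Set.range w := by
    rw [← Set.range_comp]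
    exact congrArg Set.range (funext fun k => (hw k).symm)
  rw [h2, ← Submodule.map_span] at h1
  obtain ⟨η, hη, h⟩ := h1
  exact A.logQuot_injective hA h ▸ hη

variable {A} in
theorem IsFree.exists_span_eq_linearIdeal (h : A.IsFree) :
    ∃ (r : ℕ) (g : Fin r → MvPolynomial (Fin n) (MvPolynomial (Fin ℓ) ℂ)),
      r ≤ ℓ ∧ Ideal.span (Set.range g) = A.linearIdeal := by
  have : Module.Free (MvPolynomial (Fin ℓ) ℂ) (A.logDer ℂ) := h
  let ι := Module.Free.ChooseBasisIndex (MvPolynomial (Fin ℓ) ℂ) (A.logDer ℂ)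
  let b : Module.Basis ι _ _ := Module.Free.chooseBasis (MvPolynomial (Fin ℓ) ℂ) (A.logDer ℂ)
  let e : A.logDer ℂ →ₗ[MvPolynomial (Fin ℓ) ℂ] (Fin ℓ → MvPolynomial (Fin ℓ) ℂ) :=
    { toFun θ j := θ.1 (X j), map_add' _ _ := rfl, map_smul' _ _ := rfl }
  have he : Function.Injective e := fun θ η h =>
    Subtype.ext (MvPolynomial.derivation_ext fun j => congrFun h j)
  have hli : LinearIndependent _ (e ∘ b) :=
    b.linearIndependent.map_injOn e he.injOn
  have hfin : Finite ι := hli.finite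
  have := Fintype.ofFinite ι
  refine ⟨Fintype.card ι, fun k => linearForm _ n (A.logQuot (b ((Fintype.equivFin ι).symm k))),
    ?_, ?_⟩
  · simpa using hli.fintype_card_le_finrank
  refine le_antisymm (Ideal.span_mono ?_) (Ideal.span_le.mpr ?_)
  · rintro _ ⟨k, rfl⟩
    exact ⟨_, rfl⟩
  · rintro _ ⟨θ, rfl⟩
    rw [← b.sum_repr θ]
    simp only [map_sum, map_smul]
    refine Ideal.sum_mem _ fun i _ => ?_
    rw [smul_eq_C_mul]
    exact Ideal.mul_mem_left _ _ (Ideal.subset_span ⟨Fintype.equivFin ι i, by simp⟩)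

end CentralArrangement

end

theorem mainTheorem5 {ℓ n : ℕ} (A : CentralArrangement ℓ n) (hA : A.IsEssential) :
    A.logIdeal.IsCompleteIntersection ↔ A.IsFree := by
  let Φ := (MvPolynomial.commAlgEquiv ℂ (Fin ℓ) (Fin n)).toRingEquiv
  have hΦ : A.logIdeal.map Φ = A.linearIdeal := A.map_logIdeal
  constructor
  · rintro ⟨r, g, hr, hg⟩
    rw [A.height_logIdeal hA, Nat.cast_inj] at hr
    refine A.isFree_of_span_eq_linearIdeal hA hr.ge (Φ ∘ g) ?_
    rw [← hΦ, ← hg, Ideal.map_span, Set.range_comp]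
  · intro h
    obtain ⟨r, g, hr, hg⟩ := CentralArrangement.IsFree.exists_span_eq_linearIdeal h
    have hle : A.linearIdeal.height ≤ r := by
      obtain ⟨P, hP⟩ := Ideal.nonempty_minimalPrimes A.linearIdeal_ne_top
      exact (Ideal.height_mono hP.1.2).trans
        (Ideal.height_le_of_mem_minimalPrimes_span_range g (hg ▸ hP))
    have hr' : ℓ = r := by
      refine le_antisymm ?_ hr
      exact_mod_cast (A.le_height_linearIdeal hA).trans hle
    refine ⟨r, Φ.symm ∘ g, ?_, ?_⟩
    · rw [A.height_logIdeal hA, hr']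
    · rw [Set.range_comp, ← Ideal.map_span, hg, ← hΦ]
      exact Ideal.map_of_equiv Φ
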